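/- A \emph{real simplicial tree} is a simplicial tree $X$ (the points of the edges belong to $X$) endowed with a distance $d$ for which the image of every injective path is isometric to a segment of $\mathbb{R}$. Let $\mathrm{Isom}(X)$ be the group of bijective isometries of $X$ that send vertices to vertices and edges to edges, with the group topology for which the pointwise fixators of the compact subsets of $X$ form a basis of neighbourhoods of the identity. Let $X$ be a real simplicial tree, bipartite with (finite) valences $n_1\geq 2$ and $n_2\geq 2$ where $(n_1,n_2)\neq(2,2)$ (the vertices are of two types, adjacent vertices have different types, and each vertex of the $i$-th type has exactly $n_i$ neighbours), all of whose edges have the same length. Let $\Gamma_0$ be a discrete torsion-free subgroup of $\mathrm{Isom}(X)$ such that the quotient graph $\Gamma_0\backslash X$ is finite, and let $x_0,x_0'\in X$. A group homomorphism $\rho:\Gamma_0\to\mathrm{Isom}(X)$ is called \emph{admissible} if for every $R>0$ one has $$d(x_0',\rho(\gamma)\cdot x_0')\ \leq\ d(x_0,\gamma\cdot x_0)-R$$ for all but finitely many $\gamma\in\Gamma_0$ (this does not depend on the choice of $x_0,x_0'$). Then there is no admissible group homomorphism $\rho:\Gamma_0\to\mathrm{Isom}(X)$ that is injective with discrete image.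 -/

import Mathlib

open scoped Pointwise

/-- A subset of a metric space is isometric to a compact segment of the real line. -/
def IsRealSegment {X : Type*} [MetricSpace X] (s : Set X) : Prop :=
  ∃ l : ℝ, 0 ≤ l ∧ Nonempty (s ≃ᵢ Set.Icc (0 : ℝ) l)

/-- The metric segment `[u, v]`: the points lying between `u` and `v`. -/
def metricSegment {X : Type*} [MetricSpace X] (u v : X) : Set X :=
  {x | dist u x + dist x v = dist u v}

/-- The structure of a real simplicial tree on a metric space `X`: a simplicial tree whose
underlying space, edges included, is `X`, and whose distance is such that the image of every
injective path is isometric to a real segment. Different edges may have different lengths. -/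
structure SimplicialRealTree (X : Type*) [MetricSpace X] where
  /-- the set of vertices -/
  vertices : Set X
  /-- the combinatorial graph -/
  graph : SimpleGraph vertices
  isTree : graph.IsTree
  /-- a (closed) edge is the segment between two adjacent vertices -/
  edge_isRealSegment : ∀ u v : vertices, graph.Adj u v → IsRealSegment (metricSegment (u : X) v)
  /-- `X` is the union of its vertices and its edges -/
  cover : ∀ x : X, x ∈ vertices ∨ ∃ u v : vertices, graph.Adj u v ∧ x ∈ metricSegment (u : X) v
  /-- the only vertices on an edge are its two extremities -/
  vertex_of_mem_edge : ∀ u v w : vertices, graph.Adj u v →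
    (w : X) ∈ metricSegment (u : X) v → w = u ∨ w = v
  /-- two distinct edges meet only at vertices -/
  mem_vertices_of_mem_edges : ∀ u v u' v' : vertices, graph.Adj u v → graph.Adj u' v' →
    s(u, v) ≠ s(u', v') → ∀ x : X, x ∈ metricSegment (u : X) v → x ∈ metricSegment (u' : X) v' →
      x ∈ vertices
  /-- the image of every injective path is isometric to a real segment -/
  injective_path : ∀ c : unitInterval → X, Continuous c → Function.Injective c →
    IsRealSegment (Set.range c)

namespace SimplicialRealTree

variable {X : Type*} [MetricSpace X] (T : SimplicialRealTree X)

/-- The set of closed edges, as subsets of `X`. -/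
def edges : Set (Set X) :=
  {e | ∃ u v : T.vertices, T.graph.Adj u v ∧ e = metricSegment (u : X) v}

/-- The tree is bipartite with valences `n₁` and `n₂`: its vertices are of two types, adjacent
vertices have different types, each vertex of the first type has exactly `n₁` neighbours, and each
vertex of the second type has exactly `n₂` neighbours. -/
def IsBipartiteOfValences (n₁ n₂ : ℕ) : Prop :=
  ∃ first : Set T.vertices,
    (∀ u v : T.vertices, T.graph.Adj u v → (u ∈ first ↔ v ∉ first)) ∧
    (∀ v : T.vertices, v ∈ first → (T.graph.neighborSet v).encard = n₁) ∧
    (∀ v : T.vertices, v ∉ first → (T.graph.neighborSet v).encard = n₂)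

/-- All the edges have the same length. -/
def EdgesOfEqualLength : Prop :=
  ∃ L : ℝ, ∀ u v : T.vertices, T.graph.Adj u v → dist (u : X) v = L

/-- `Isom(X)`: the group of bijective isometries of `X` that send vertices to vertices and edges
to edges. -/
def isom : Subgroup (X ≃ᵢ X) where
  carrier := {g | (∀ x : X, g x ∈ T.vertices ↔ x ∈ T.vertices) ∧
    ∀ e : Set X, g '' e ∈ T.edges ↔ e ∈ T.edges}
  one_mem' := by
    refine ⟨fun x => Iff.rfl, fun e => ?_⟩
    have : ((1 : X ≃ᵢ X) : X → X) = id := rfl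
    rw [this, Set.image_id]
  mul_mem' := by
    rintro a b ⟨ha, ha'⟩ ⟨hb, hb'⟩
    refine ⟨fun x => (ha (b x)).trans (hb x), fun e => ?_⟩
    have : ((a * b : X ≃ᵢ X) : X → X) = a ∘ b := rfl
    rw [this, Set.image_comp]
    exact (ha' _).trans (hb' e)
  inv_mem' := by
    rintro a ⟨ha, ha'⟩
    refine ⟨fun x => ?_, fun e => ?_⟩
    · rw [← ha, IsometryEquiv.apply_inv_self]
    · rw [← ha', ← Set.image_comp]
      have : (a : X → X) ∘ ((a⁻¹ : X ≃ᵢ X) : X → X) = id := by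
        funext x
        exact IsometryEquiv.apply_inv_self a x
      rw [this, Set.image_id]

instance : MulAction T.isom X where
  smul g x := (g : X ≃ᵢ X) x
  one_smul _ := rfl
  mul_smul _ _ _ := rfl

/-- The pointwise fixator of a subset `K` of `X` in `Isom(X)`. -/
def fixator (K : Set X) : Set T.isom := {g | ∀ x ∈ K, g • x = x}

/-- The fixators of the compact subsets of `X` form a basis of neighbourhoods of the identity for a
group topology. -/
abbrev isomBasis : GroupFilterBasis T.isom where
  sets := {U | ∃ K : Set X, IsCompact K ∧ U = T.fixator K}
  nonempty := ⟨_, ∅, isCompact_empty, rfl⟩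
  inter_sets := by
    rintro _ _ ⟨K, hK, rfl⟩ ⟨K', hK', rfl⟩
    exact ⟨_, ⟨K ∪ K', hK.union hK', rfl⟩,
      fun g hg => ⟨fun x hx => hg x (Or.inl hx), fun x hx => hg x (Or.inr hx)⟩⟩
  one' := by
    rintro _ ⟨K, -, rfl⟩ x -
    exact one_smul _ x
  mul' := by
    rintro _ ⟨K, hK, rfl⟩
    refine ⟨_, ⟨K, hK, rfl⟩, ?_⟩
    rintro _ ⟨a, ha, b, hb, rfl⟩ x hx
    change (a * b) • x = x
    rw [mul_smul, hb x hx, ha x hx]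
  inv' := by
    rintro _ ⟨K, hK, rfl⟩
    refine ⟨_, ⟨K, hK, rfl⟩, fun a ha x hx => ?_⟩
    rw [inv_smul_eq_iff, ha x hx]
  conj' := by
    rintro g _ ⟨K, hK, rfl⟩
    refine ⟨_, ⟨(fun x : X => g⁻¹ • x) '' K,
      hK.image (IsometryEquiv.continuous ((g⁻¹ : T.isom) : X ≃ᵢ X)), rfl⟩, fun a ha x hx => ?_⟩
    change (g * a * g⁻¹) • x = x
    rw [mul_smul, mul_smul, ha _ ⟨x, hx, rfl⟩, smul_inv_smul]

/-- The topology of `Isom(X)`: the fixators of the compact subsets of `X` form a basis of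
neighbourhoods of the identity. -/
instance : TopologicalSpace T.isom := T.isomBasis.topology

/-- The quotient graph `Γ\X` is finite: there are finitely many orbits of vertices and finitely
many orbits of edges. -/
def FiniteQuotient (Γ : Subgroup T.isom) : Prop :=
  ((fun x : X => MulAction.orbit Γ x) '' T.vertices).Finite ∧
  ((fun e : Set X => MulAction.orbit Γ e) '' T.edges).Finite

/-- A homomorphism `ρ : Γ → Isom(X')`, where `Γ` is a subgroup of `Isom(X)`, is admissible with
respect to base points `x₀` and `x₀'` if for every `R > 0` one has
`d(x₀', ρ(γ) x₀') ≤ d(x₀, γ x₀) - R` for all but finitely many `γ` in `Γ`. -/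
def Admissible {X' : Type*} [MetricSpace X'] (T' : SimplicialRealTree X') (Γ : Subgroup T.isom)
    (x₀ : X) (x₀' : X') (ρ : Γ →* T'.isom) : Prop :=
  ∀ R : ℝ, 0 < R → ∀ᶠ γ : Γ in Filter.cofinite,
    dist x₀' (ρ γ • x₀') ≤ dist x₀ ((γ : T.isom) • x₀) - R

end SimplicialRealTree

/-!
Let `b r` be the number of vertices at distance at most `r` from a vertex `v`. In the rooted tree
every vertex has two grandchildren, and distinct vertices have disjoint sets of grandchildren, so
`2 * b r ≤ b (r + c)` for some `c`. Since `Γ₀` has finitely many orbits of vertices, `b r` is at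
most a constant times the number of `γ` with `d(v, γ v) ≤ r + M`. The stabilizer of `v` in `Γ₀`
acting through `ρ` is finite, so at most a constant times `b r` elements `γ` satisfy
`d(v, ρ γ v) ≤ r`. If `ρ` is admissible, then up to finitely many exceptions
`d(v, γ v) ≤ r + R + M` forces `d(v, ρ γ v) ≤ r`. Hence `b (r + R) ≤ A * b r + B` with `A`
independent of `R`, against exponential growth once `R` is large.
-/

section Graphs

variable {V : Type*} {G : SimpleGraph V}

theorem finite_setOf_exists_walk_length_le (hG : ∀ v, (G.neighborSet v).Finite) (n : ℕ) (v : V) :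
    {w | ∃ p : G.Walk v w, p.length ≤ n}.Finite := by
  induction n generalizing v with
  | zero =>
    refine (Set.finite_singleton v).subset ?_
    rintro w ⟨p, hp⟩
    exact (p.eq_of_length_eq_zero (Nat.le_zero.1 hp)).symm
  | succ n ih =>
    refine ((Set.finite_singleton v).union ((hG v).biUnion fun u _ => ih u)).subset ?_
    rintro w ⟨_ | ⟨h, p⟩, hp⟩
    · exact Or.inl rfl
    · exact Or.inr (Set.mem_biUnion h ⟨p, Nat.le_of_succ_le_succ hp⟩)

/-- The children of a vertex `u` of a graph rooted at `r`: the neighbours of `u` that are farther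
from `r` than `u` is. -/
def rootedChildren (G : SimpleGraph V) (r u : V) : Set V :=
  {w | G.Adj u w ∧ G.dist r w = G.dist r u + 1}

variable {r u u' w : V}

theorem eq_of_mem_rootedChildren (hG : G.IsTree) (hu : w ∈ rootedChildren G r u)
    (hu' : w ∈ rootedChildren G r u') : u = u' := by
  obtain ⟨p, hp⟩ := hG.1.exists_walk_length_eq_dist r u
  obtain ⟨q, hq⟩ := hG.1.exists_walk_length_eq_dist r u'
  have hp' : (p.concat hu.1).IsPath :=
    SimpleGraph.Walk.isPath_of_length_eq_dist _ (by rw [p.length_concat, hp, hu.2])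
  have hq' : (q.concat hu'.1).IsPath :=
    SimpleGraph.Walk.isPath_of_length_eq_dist _ (by rw [q.length_concat, hq, hu'.2])
  exact (SimpleGraph.Walk.concat_inj
    (congrArg Subtype.val ((hG.2.subsingleton_path r w).elim ⟨_, hp'⟩ ⟨_, hq'⟩))).1

theorem encard_neighborSet_le_encard_rootedChildren_add_one (hG : G.IsTree) (r u : V) :
    (G.neighborSet u).encard ≤ (rootedChildren G r u).encard + 1 := by
  have hsub : G.neighborSet u ⊆ rootedChildren G r u ∪ {w | u ∈ rootedChildren G r w} := by
    intro w hw
    rcases hG.dist_eq_dist_add_one_of_adj r hw with h | h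
    · exact Or.inr ⟨hw.symm, h⟩
    · exact Or.inl ⟨hw, h⟩
  have hparent : {w | u ∈ rootedChildren G r w}.encard ≤ 1 :=
    Set.encard_le_one_iff.2 fun _ _ => eq_of_mem_rootedChildren hG
  calc (G.neighborSet u).encard
      ≤ (rootedChildren G r u).encard + {w | u ∈ rootedChildren G r w}.encard :=
        (Set.encard_le_encard hsub).trans (Set.encard_union_le _ _)
    _ ≤ (rootedChildren G r u).encard + 1 := by gcongr

theorem rootedChildren_nonempty (hG : G.IsTree) (r : V) (hu : 2 ≤ (G.neighborSet u).encard) :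
    (rootedChildren G r u).Nonempty := by
  have h : (1 : ℕ∞) + 1 ≤ (rootedChildren G r u).encard + 1 := by
    rw [one_add_one_eq_two]
    exact hu.trans (encard_neighborSet_le_encard_rootedChildren_add_one hG r u)
  exact Set.one_le_encard_iff_nonempty.1 ((ENat.add_le_add_iff_right ENat.one_ne_top).1 h)

theorem rootedChildren_nontrivial (hG : G.IsTree) (r : V) (hu : 3 ≤ (G.neighborSet u).encard) :
    (rootedChildren G r u).Nontrivial := by
  have h : (2 : ℕ∞) + 1 ≤ (rootedChildren G r u).encard + 1 := by
    rw [two_add_one_eq_three]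
    exact hu.trans (encard_neighborSet_le_encard_rootedChildren_add_one hG r u)
  exact Set.one_lt_encard_iff_nontrivial.1 <|
    Nat.one_lt_ofNat.trans_le ((ENat.add_le_add_iff_right ENat.one_ne_top).1 h)

theorem rootedGrandchildren_nontrivial (hG : G.IsTree) (h2 : ∀ v, 2 ≤ (G.neighborSet v).encard)
    (h3 : ∀ u v, G.Adj u v → 3 ≤ (G.neighborSet u).encard ∨ 3 ≤ (G.neighborSet v).encard)
    (r u : V) : {w | ∃ c ∈ rootedChildren G r u, w ∈ rootedChildren G r c}.Nontrivial := by
  obtain ⟨c, hc⟩ := rootedChildren_nonempty hG r (h2 u)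
  rcases h3 u c hc.1 with hu | hc3
  · obtain ⟨a, ha, b, hb, hab⟩ := rootedChildren_nontrivial hG r hu
    obtain ⟨w₁, hw₁⟩ := rootedChildren_nonempty hG r (h2 a)
    obtain ⟨w₂, hw₂⟩ := rootedChildren_nonempty hG r (h2 b)
    refine ⟨w₁, ⟨a, ha, hw₁⟩, w₂, ⟨b, hb, hw₂⟩, ?_⟩
    rintro rfl
    exact hab (eq_of_mem_rootedChildren hG hw₁ hw₂)
  · obtain ⟨w₁, hw₁, w₂, hw₂, hne⟩ := rootedChildren_nontrivial hG r hc3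
    exact ⟨w₁, ⟨c, hc, hw₁⟩, w₂, ⟨c, hc, hw₂⟩, hne⟩

theorem exists_injective_prod_bool_adj_adj (hG : G.IsTree)
    (h2 : ∀ v, 2 ≤ (G.neighborSet v).encard)
    (h3 : ∀ u v, G.Adj u v → 3 ≤ (G.neighborSet u).encard ∨ 3 ≤ (G.neighborSet v).encard) :
    ∃ f : V × Bool → V, Function.Injective f ∧ ∀ p, ∃ c, G.Adj p.1 c ∧ G.Adj c (f p) := by
  obtain ⟨r⟩ := hG.1.nonempty
  choose w₁ h₁ w₂ h₂ hne using rootedGrandchildren_nontrivial hG h2 h3 r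
  let f : V × Bool → V := fun p => if p.2 then w₁ p.1 else w₂ p.1
  have hf : ∀ p, ∃ c ∈ rootedChildren G r p.1, f p ∈ rootedChildren G r c
    | (u, true) => h₁ u
    | (u, false) => h₂ u
  refine ⟨f, ?_, fun p => (hf p).imp fun c hc => ⟨hc.1.1, hc.2.1⟩⟩
  rintro ⟨u, i⟩ ⟨u', j⟩ h
  obtain ⟨c, hc, hw⟩ := hf (u, i)
  obtain ⟨c', hc', hw'⟩ := hf (u', j)
  obtain rfl := eq_of_mem_rootedChildren hG hw (h ▸ hw')
  obtain rfl := eq_of_mem_rootedChildren hG hc hc'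
  cases i <;> cases j
  · rfl
  · exact absurd h.symm (hne u)
  · exact absurd h (hne u)
  · rfl

end Graphs

section Segments

variable {X : Type*} [MetricSpace X] {u v : X}

theorem left_mem_metricSegment (u v : X) : u ∈ metricSegment u v := by
  rw [metricSegment, Set.mem_ofPred_eq, dist_self, zero_add]

theorem right_mem_metricSegment (u v : X) : v ∈ metricSegment u v := by
  rw [metricSegment, Set.mem_ofPred_eq, dist_self, add_zero]

theorem diam_metricSegment (u v : X) : Metric.diam (metricSegment u v) = dist u v := by
  have hle : ∀ x ∈ metricSegment u v, ∀ y ∈ metricSegment u v, dist x y ≤ dist u v := by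
    intro x hx y hy
    have hx : dist u x + dist x v = dist u v := hx
    have hy : dist u y + dist y v = dist u v := hy
    linarith [dist_triangle_left x y u, dist_triangle_right x y v]
  exact le_antisymm (Metric.diam_le_of_forall_dist_le dist_nonneg hle) <|
    Metric.dist_le_diam_of_mem (Metric.isBounded_iff.2 ⟨_, fun x hx y hy => hle x hx y hy⟩)
      (left_mem_metricSegment u v) (right_mem_metricSegment u v)

theorem IsRealSegment.eq_of_dist_eq_of_dist_eq {s : Set X} (hs : IsRealSegment s) {y z : X}
    (hu : u ∈ s) (hv : v ∈ s) (hy : y ∈ s) (hz : z ∈ s) (huv : u ≠ v)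
    (huyz : dist u y = dist u z) (hvyz : dist v y = dist v z) : y = z := by
  obtain ⟨l, -, ⟨e⟩⟩ := hs
  have hdist : ∀ a b : s, dist (a : X) b = |(e a : ℝ) - e b| := fun a b => (e.dist_eq a b).symm
  have hne : (e ⟨u, hu⟩ : ℝ) ≠ e ⟨v, hv⟩ := fun h =>
    huv (congrArg Subtype.val (e.injective (Subtype.ext h)))
  rw [hdist ⟨u, hu⟩ ⟨y, hy⟩, hdist ⟨u, hu⟩ ⟨z, hz⟩, abs_eq_abs] at huyz
  rw [hdist ⟨v, hv⟩ ⟨y, hy⟩, hdist ⟨v, hv⟩ ⟨z, hz⟩, abs_eq_abs] at hvyz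
  suffices h : (e ⟨y, hy⟩ : ℝ) = e ⟨z, hz⟩ from
    congrArg Subtype.val (e.injective (Subtype.ext h))
  rcases huyz with h | h
  · linarith
  rcases hvyz with h' | h'
  · linarith
  -- otherwise `u` and `v` are both the midpoint of `y` and `z`
  · exact absurd (by linarith) hne

theorem IsRealSegment.exists_injective_path (h : IsRealSegment (metricSegment u v)) (huv : u ≠ v) :
    ∃ c : Path u v, Function.Injective c ∧ Set.range c ⊆ metricSegment u v := by
  obtain ⟨l, -, ⟨e⟩⟩ := h
  set a := e ⟨u, left_mem_metricSegment u v⟩ with ha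
  set b := e ⟨v, right_mem_metricSegment u v⟩ with hb
  have hab : (a : ℝ) ≠ b := fun h => huv (congrArg Subtype.val (e.injective (Subtype.ext h)))
  have hmem : ∀ t : unitInterval, AffineMap.lineMap (a : ℝ) (b : ℝ) (t : ℝ) ∈ Set.Icc (0 : ℝ) l :=
    fun t => (convex_Icc (0 : ℝ) l).lineMap_mem a.2 b.2 t.2
  let c : Path u v :=
    { toFun := fun t => (e.symm ⟨_, hmem t⟩ : metricSegment u v)
      continuous_toFun := continuous_subtype_val.comp <| e.symm.continuous.comp <|
        (AffineMap.lineMap_continuous.comp continuous_subtype_val).subtype_mk hmem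
      source' := by simp [ha]
      target' := by simp [hb] }
  refine ⟨c, fun s t hst => Subtype.ext (AffineMap.lineMap_injective ℝ hab ?_), ?_⟩
  · exact congrArg Subtype.val (e.symm.injective (Subtype.ext hst))
  · rintro _ ⟨t, rfl⟩
    exact (e.symm ⟨_, hmem t⟩).2

theorem path_trans_injective {Y : Type*} [TopologicalSpace Y] {u v w : Y} {c : Path u v}
    {c' : Path v w} (hc : Function.Injective c) (hc' : Function.Injective c')
    (h : Set.range c ∩ Set.range c' ⊆ {v}) : Function.Injective (c.trans c') := by
  have hmixed : ∀ s t : unitInterval, (s : ℝ) ≤ 1 / 2 → ¬ (t : ℝ) ≤ 1 / 2 →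
      c.trans c' s ≠ c.trans c' t := by
    intro s t hs ht hst
    rw [Path.trans_apply, Path.trans_apply, dif_pos hs, dif_neg ht] at hst
    have hv := h ⟨⟨_, rfl⟩, ⟨_, hst.symm⟩⟩
    rw [Set.mem_singleton_iff, hst] at hv
    have ht0 : 2 * (t : ℝ) - 1 = 0 := congrArg Subtype.val (hc' (hv.trans c'.source.symm))
    exact ht (by linarith)
  intro s t hst
  by_cases hs : (s : ℝ) ≤ 1 / 2 <;> by_cases ht : (t : ℝ) ≤ 1 / 2
  · rw [Path.trans_apply, Path.trans_apply, dif_pos hs, dif_pos ht] at hst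
    have : 2 * (s : ℝ) = 2 * t := congrArg Subtype.val (hc hst)
    exact Subtype.ext (by linarith)
  · exact absurd hst (hmixed s t hs ht)
  · exact absurd hst.symm (hmixed t s ht hs)
  · rw [Path.trans_apply, Path.trans_apply, dif_neg hs, dif_neg ht] at hst
    have : 2 * (s : ℝ) - 1 = 2 * t - 1 := congrArg Subtype.val (hc' hst)
    exact Subtype.ext (by linarith)

theorem IsRealSegment.dist_add_dist_of_mem_range {c : Path u v} (h : IsRealSegment (Set.range c))
    (hc : Function.Injective c) {x : X} (hx : x ∈ Set.range c) :
    dist u x + dist x v = dist u v := by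
  obtain ⟨t, rfl⟩ := hx
  obtain ⟨l, -, ⟨e⟩⟩ := h
  let g : unitInterval → ℝ := fun t => (e ⟨c t, t, rfl⟩ : Set.Icc (0 : ℝ) l)
  have hg : Continuous g :=
    continuous_subtype_val.comp (e.continuous.comp (c.continuous.subtype_mk _))
  have hginj : Function.Injective g := fun s t hst =>
    hc (congrArg Subtype.val (e.injective (Subtype.ext hst)))
  have hdist : ∀ s t, dist (c s) (c t) = |g s - g t| := fun s t =>
    (e.dist_eq ⟨c s, s, rfl⟩ ⟨c t, t, rfl⟩).symm
  suffices h : |g 0 - g t| + |g t - g 1| = |g 0 - g 1| by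
    rwa [← hdist, ← hdist, ← hdist, c.source, c.target] at h
  have h0 : 0 ≤ t := unitInterval.nonneg'
  have h1 : t ≤ 1 := unitInterval.le_one'
  rcases hg.strictMono_of_inj_boundedOrder' hginj with hmono | hanti
  · rw [abs_sub_comm (g 0) (g t), abs_sub_comm (g t) (g 1), abs_sub_comm (g 0) (g 1),
      abs_of_nonneg (sub_nonneg.2 (hmono.monotone h0)),
      abs_of_nonneg (sub_nonneg.2 (hmono.monotone h1)),
      abs_of_nonneg (sub_nonneg.2 (hmono.monotone (h0.trans h1)))]
    ring
  · rw [abs_of_nonneg (sub_nonneg.2 (hanti.antitone h0)),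
      abs_of_nonneg (sub_nonneg.2 (hanti.antitone h1)),
      abs_of_nonneg (sub_nonneg.2 (hanti.antitone (h0.trans h1)))]
    ring

end Segments

section GroupActions

theorem dist_smul_self_le {M X : Type*} [PseudoMetricSpace X] [SMul M X] [IsIsometricSMul M X]
    (g : M) (x y : X) : dist x (g • x) ≤ dist y (g • y) + 2 * dist x y := by
  have h := dist_triangle4 x y (g • y) (g • x)
  rw [dist_smul, dist_comm y x] at h
  linarith

variable {G α : Type*} [Group G] [MulAction G α]

theorem exists_finite_forall_exists_smul_eq {S : Set α}
    (hS : ((fun x => MulAction.orbit G x) '' S).Finite) :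
    ∃ F : Set α, F.Finite ∧ ∀ x ∈ S, ∃ g : G, ∃ y ∈ F, g • y = x := by
  obtain ⟨F, -, hF⟩ := Set.exists_subset_bijOn S (fun x => MulAction.orbit G x)
  refine ⟨F, Set.Finite.of_finite_image (hF.image_eq ▸ hS) hF.injOn, fun x hx => ?_⟩
  obtain ⟨y, hy, hyx⟩ := hF.surjOn ⟨x, hx, rfl⟩
  obtain ⟨g, hg⟩ : x ∈ MulAction.orbit G y := MulAction.orbit_eq_iff.1 hyx.symm
  exact ⟨g, y, hy, hg⟩

theorem encard_setOf_smul_mem_le {Γ : Type*} [Group Γ] (ρ : Γ →* G) (a : α) (S : Set α) :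
    {γ : Γ | ρ γ • a ∈ S}.encard ≤
      S.encard * ((MulAction.stabilizer G a).comap ρ : Set Γ).encard := by
  let σ : α → Γ := Function.invFun fun γ => ρ γ • a
  have hσ : ∀ γ, ρ (σ (ρ γ • a)) • a = ρ γ • a := fun γ =>
    Function.invFun_eq (f := fun γ => ρ γ • a) ⟨γ, rfl⟩
  rw [← Set.encard_prod]
  refine Set.encard_le_encard_of_injOn (f := fun γ => (ρ γ • a, (σ (ρ γ • a))⁻¹ * γ)) ?_ ?_
  · intro γ hγ
    refine ⟨hγ, ?_⟩
    change ρ ((σ (ρ γ • a))⁻¹ * γ) • a = a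
    rw [map_mul, map_inv, mul_smul, inv_smul_eq_iff, hσ]
  · intro γ _ γ' _ h
    obtain ⟨horbit, hstab⟩ := Prod.ext_iff.1 h
    simp only at horbit hstab
    rw [horbit] at hstab
    exact mul_left_cancel hstab

theorem finite_comap_of_finite_ker {Γ : Type*} [Group Γ] (ρ : Γ →* G) [Finite ρ.ker]
    {H : Subgroup G} (hH : Finite ↥(H ⊓ ρ.range)) : Finite (H.comap ρ) := by
  rw [(ρ.domRestrict (H.comap ρ)).finite_iff_finite_ker_range, ρ.ker_domRestrict,
    ρ.domRestrict_range, Subgroup.map_comap_eq, inf_comm]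
  exact ⟨Finite.of_injective (fun γ => (⟨γ, γ.2⟩ : ρ.ker)) fun _ _ h =>
    Subtype.ext (Subtype.ext (congrArg (fun γ : ρ.ker => (γ : Γ)) h)), hH⟩

end GroupActions

namespace SimplicialRealTree

variable {X : Type*} [MetricSpace X] {T : SimplicialRealTree X}

section Metric

variable {u v w : T.vertices}

theorem coe_ne_coe_of_adj (h : T.graph.Adj u v) : (u : X) ≠ v :=
  Subtype.coe_injective.ne h.ne

/-- The geometric realization of a walk, that is, the union in `X` of its closed edges. -/
def realization (p : T.graph.Walk u v) : Set X :=
  ⋃ d ∈ p.darts, metricSegment (d.fst : X) d.snd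

theorem metricSegment_inter_realization_subset (h : T.graph.Adj u v) {p : T.graph.Walk v w}
    (hp : (p.cons h).IsPath) : metricSegment (u : X) v ∩ realization p ⊆ {(v : X)} := by
  rintro x ⟨hxuv, hxp⟩
  obtain ⟨d, hd, hxd⟩ : ∃ d ∈ p.darts, x ∈ metricSegment (d.fst : X) d.snd := by
    simpa only [realization, Set.mem_iUnion, exists_prop] using hxp
  have hfst := p.dart_fst_mem_support_of_mem_darts hd
  have hsnd := p.dart_snd_mem_support_of_mem_darts hd
  have hu : u ∉ p.support := ((SimpleGraph.Walk.cons_isPath_iff h p).1 hp).2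
  have hne : s(u, v) ≠ s(d.fst, d.snd) := fun he => by
    rcases Sym2.mem_iff.1 (he ▸ Sym2.mem_mk_left u v) with rfl | rfl
    exacts [hu hfst, hu hsnd]
  have hx := T.mem_vertices_of_mem_edges u v d.fst d.snd h d.adj hne x hxuv hxd
  rcases T.vertex_of_mem_edge u v ⟨x, hx⟩ h hxuv with rfl | rfl
  · rcases T.vertex_of_mem_edge _ _ ⟨x, hx⟩ d.adj hxd with he | he
    exacts [absurd (he ▸ hfst) hu, absurd (he ▸ hsnd) hu]
  · rfl

theorem realization_cons (h : T.graph.Adj u v) (p : T.graph.Walk v w) :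
    realization (p.cons h) = metricSegment (u : X) v ∪ realization p := by
  simp only [realization, SimpleGraph.Walk.darts_cons, List.mem_cons,
    Set.iUnion_iUnion_eq_or_left]

theorem exists_injective_path_of_isPath_cons (h : T.graph.Adj u v) (p : T.graph.Walk v w)
    (hp : (p.cons h).IsPath) : ∃ c : Path (u : X) w, Function.Injective c ∧
      Set.range c ⊆ realization (p.cons h) ∧ (v : X) ∈ Set.range c := by
  induction p generalizing u with
  | nil =>
    obtain ⟨c, hc, hcuv⟩ := (T.edge_isRealSegment _ _ h).exists_injective_path (coe_ne_coe_of_adj h)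
    rw [realization_cons]
    exact ⟨c, hc, hcuv.trans Set.subset_union_left, 1, c.target⟩
  | cons h' p ih =>
    obtain ⟨c, hc, hcuv⟩ := (T.edge_isRealSegment _ _ h).exists_injective_path (coe_ne_coe_of_adj h)
    obtain ⟨c', hc', hcp, -⟩ := ih h' ((SimpleGraph.Walk.cons_isPath_iff h _).1 hp).1
    refine ⟨c.trans c', path_trans_injective hc hc' ?_, ?_, ?_⟩
    · exact (Set.inter_subset_inter hcuv hcp).trans (metricSegment_inter_realization_subset h hp)
    · rw [Path.trans_range, realization_cons]
      exact Set.union_subset_union hcuv hcp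
    · rw [Path.trans_range]
      exact Or.inl ⟨1, c.target⟩

theorem dist_add_dist_of_isPath_cons (h : T.graph.Adj u v) {p : T.graph.Walk v w}
    (hp : (p.cons h).IsPath) : dist (u : X) v + dist (v : X) w = dist (u : X) w := by
  obtain ⟨c, hc, -, hv⟩ := exists_injective_path_of_isPath_cons h p hp
  exact (T.injective_path c c.continuous hc).dist_add_dist_of_mem_range hc hv

theorem length_mul_le_dist {ℓ : ℝ} (hℓ : ∀ u v : T.vertices, T.graph.Adj u v → ℓ ≤ dist (u : X) v)
    {p : T.graph.Walk u v} (hp : p.IsPath) : p.length * ℓ ≤ dist (u : X) v := by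
  induction p with
  | nil => simp only [SimpleGraph.Walk.length_nil, Nat.cast_zero, zero_mul, dist_self, le_refl]
  | cons h p ih =>
    rw [← dist_add_dist_of_isPath_cons h hp, SimpleGraph.Walk.length_cons, Nat.cast_succ,
      add_one_mul, add_comm]
    exact add_le_add (hℓ _ _ h) (ih hp.of_cons)

end Metric

section Balls

/-- The set of vertices at distance at most `r` from a point `v` of the tree. Its cardinality, as a
function of `r`, is the growth function of the tree. -/
def vertexBall (T : SimplicialRealTree X) (v : X) (r : ℝ) : Set X :=
  T.vertices ∩ Metric.closedBall v r

theorem finite_vertexBall {ℓ : ℝ} (hℓ : 0 < ℓ)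
    (hℓT : ∀ u v : T.vertices, T.graph.Adj u v → ℓ ≤ dist (u : X) v)
    (hlf : ∀ v, (T.graph.neighborSet v).Finite) (v : T.vertices) (r : ℝ) :
    (T.vertexBall v r).Finite := by
  obtain ⟨n, hn⟩ := exists_nat_ge (r / ℓ)
  refine ((finite_setOf_exists_walk_length_le hlf n v).image Subtype.val).subset ?_
  rintro w ⟨hw, hvw⟩
  obtain ⟨p, hp, -⟩ := T.isTree.1.exists_path_of_dist v ⟨w, hw⟩
  refine ⟨⟨w, hw⟩, ⟨p, ?_⟩, rfl⟩
  have hlen : p.length * ℓ ≤ r :=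
    (length_mul_le_dist hℓT hp).trans ((dist_comm _ _).trans_le hvw)
  exact_mod_cast ((le_div_iff₀ hℓ).2 hlen).trans hn

theorem two_mul_encard_vertexBall_le {L : ℝ}
    (hL : ∀ u v : T.vertices, T.graph.Adj u v → dist (u : X) v ≤ L)
    (h2 : ∀ v, 2 ≤ (T.graph.neighborSet v).encard)
    (h3 : ∀ u v, T.graph.Adj u v →
      3 ≤ (T.graph.neighborSet u).encard ∨ 3 ≤ (T.graph.neighborSet v).encard) (v : X) (r : ℝ) :
    2 * (T.vertexBall v r).encard ≤ (T.vertexBall v (r + 2 * L)).encard := by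
  obtain ⟨f, hf, hadj⟩ := exists_injective_prod_bool_adj_adj T.isTree h2 h3
  let B : ℝ → Set T.vertices := fun r => {w | dist (w : X) v ≤ r}
  have hB : ∀ r, (T.vertexBall v r).encard = (B r).encard := fun r => by
    rw [← Subtype.val_injective.encard_image, vertexBall, ← Subtype.image_preimage_coe]
    rfl
  have hmaps : Set.MapsTo f (B r ×ˢ Set.univ) (B (r + 2 * L)) := by
    rintro p ⟨hp : dist (p.1 : X) v ≤ r, -⟩
    obtain ⟨c, hpc, hcf⟩ := hadj p
    change dist (f p : X) v ≤ r + 2 * L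
    linarith [dist_triangle4 (f p : X) c p.1 v, hL _ _ hpc.symm, hL _ _ hcf.symm]
  calc 2 * (T.vertexBall v r).encard
      = (B r ×ˢ (Set.univ : Set Bool)).encard := by
        rw [hB, Set.encard_prod, Set.encard_univ, ENat.card_eq_coe_fintype_card, Fintype.card_bool,
          mul_comm, Nat.cast_ofNat]
    _ ≤ (B (r + 2 * L)).encard := Set.encard_le_encard_of_injOn hmaps hf.injOn
    _ = (T.vertexBall v (r + 2 * L)).encard := (hB _).symm

end Balls

section Isometries

variable {Γ : Subgroup T.isom} {v : X}

instance : IsIsometricSMul T.isom X :=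
  ⟨fun g => (g : X ≃ᵢ X).isometry⟩

theorem smul_mem_vertices (g : T.isom) (hv : v ∈ T.vertices) : g • v ∈ T.vertices :=
  (g.2.1 v).2 hv

theorem FiniteQuotient.exists_dist_bounds (h : T.FiniteQuotient Γ) :
    ∃ ℓ > 0, ∃ L > 0, ∀ u v : T.vertices, T.graph.Adj u v →
      ℓ ≤ dist (u : X) v ∧ dist (u : X) v ≤ L := by
  obtain ⟨F, hF, hFT⟩ := exists_finite_forall_exists_smul_eq h.2
  let D : Set ℝ := Metric.diam '' F
  have hD : D.Finite := hF.image _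
  have hmem : ∀ u v : T.vertices, T.graph.Adj u v → dist (u : X) v ∈ D := by
    intro u v huv
    obtain ⟨γ, e, he, heq⟩ := hFT _ ⟨u, v, huv, rfl⟩
    refine ⟨e, he, ?_⟩
    rw [← diam_metricSegment, ← heq]
    exact (diam_smul (γ : T.isom) e).symm
  obtain ⟨ℓ, hℓD, hℓ⟩ : ∃ ℓ : ℝ, (∀ d ∈ D, 0 < d → ℓ ≤ d) ∧ 0 < ℓ :=
    (((Filter.eventually_all_finite hD).2 fun d _ => Filter.eventually_imp_distrib_left.2 fun hd =>
      (eventually_le_nhds hd).filter_mono nhdsWithin_le_nhds).and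
        (self_mem_nhdsWithin : Set.Ioi (0 : ℝ) ∈ nhdsWithin 0 (Set.Ioi 0))).exists
  obtain ⟨L, hL, hLD⟩ := hD.bddAbove.exists_ge 1
  exact ⟨ℓ, hℓ, L, one_pos.trans_le hL, fun u v huv =>
    ⟨hℓD _ (hmem u v huv) (dist_pos.2 (coe_ne_coe_of_adj huv)), hLD _ (hmem u v huv)⟩⟩

theorem FiniteQuotient.exists_encard_vertexBall_le (h : T.FiniteQuotient Γ) (v : X) :
    ∃ m : ℕ, ∃ M > 0, ∀ r, (T.vertexBall v r).encard ≤
      {γ : Γ | dist v ((γ : T.isom) • v) ≤ r + M}.encard * m := by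
  obtain ⟨F, hF, hFT⟩ := exists_finite_forall_exists_smul_eq h.1
  obtain ⟨M, hM, hFM⟩ := hF.isBounded.subset_closedBall_lt 0 v
  refine ⟨F.ncard, M, hM, fun r => ?_⟩
  rw [hF.cast_ncard_eq, ← Set.encard_prod]
  refine le_trans (Set.encard_le_encard ?_)
    (Set.encard_image_le (fun p : Γ × X => (p.1 : T.isom) • p.2) _)
  rintro x ⟨hx, hxv : dist x v ≤ r⟩
  obtain ⟨γ, y, hy, rfl⟩ := hFT x hx
  refine ⟨(γ, y), ⟨?_, hy⟩, rfl⟩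
  have hyv : dist y v ≤ M := hFM hy
  rw [← dist_smul (γ : T.isom)] at hyv
  change dist v ((γ : T.isom) • v) ≤ r + M
  have hγy : dist ((γ : T.isom) • y) v ≤ r := hxv
  linarith [dist_triangle_left v ((γ : T.isom) • v) ((γ : T.isom) • y)]

end Isometries

section Discrete

variable {L : ℝ}

theorem exists_isCompact_eq_one_of_fixing (H : Subgroup T.isom) [DiscreteTopology H] :
    ∃ K : Set X, IsCompact K ∧ ∀ g ∈ H, (∀ x ∈ K, g • x = x) → g = 1 := by
  have hone : ({1} : Set H) ∈ nhds (1 : H) := by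
    rw [nhds_discrete]
    exact Set.mem_singleton _
  rw [nhds_subtype, Filter.mem_comap] at hone
  obtain ⟨U, hU, hUH⟩ := hone
  obtain ⟨_, ⟨K, hK, rfl⟩, hKU⟩ := T.isomBasis.nhds_one_hasBasis.mem_iff.1 hU
  refine ⟨K, hK, fun g hg hgK => ?_⟩
  exact congrArg Subtype.val (show (⟨g, hg⟩ : H) = 1 from hUH (hKU hgK))

theorem smul_eq_self_of_forall_vertexBall
    (hL : ∀ u v : T.vertices, T.graph.Adj u v → dist (u : X) v ≤ L) (hL0 : 0 ≤ L)
    {g : T.isom} {v x : X} {r : ℝ} (hg : ∀ y ∈ T.vertexBall v (r + L), g • y = y)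
    (hx : x ∈ Metric.closedBall v r) : g • x = x := by
  have hxv : dist x v ≤ r := hx
  rcases T.cover x with hxT | ⟨a, b, hab, hxab⟩
  · exact hg x ⟨hxT, hxv.trans (le_add_of_nonneg_right hL0)⟩
  have hxab' : dist (a : X) x + dist x b = dist (a : X) b := hxab
  have hfix : ∀ y : T.vertices, dist (y : X) x ≤ L → g • (y : X) = y := fun y hy =>
    hg y ⟨y.2, by rw [Metric.mem_closedBall]; linarith [dist_triangle (y : X) x v]⟩
  have ha := hfix a (by linarith [hL a b hab, dist_nonneg (x := x) (y := (b : X))])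
  have hb := hfix b (by
    rw [dist_comm]
    linarith [hL a b hab, dist_nonneg (x := (a : X)) (y := x)])
  have hax : dist (a : X) (g • x) = dist (a : X) x := by rw [← dist_smul g (a : X) x, ha]
  have hbx : dist (b : X) (g • x) = dist (b : X) x := by rw [← dist_smul g (b : X) x, hb]
  have hgx : g • x ∈ metricSegment (a : X) b := by
    rwa [metricSegment, Set.mem_ofPred_eq, hax, dist_comm (g • x), hbx, dist_comm (b : X)]
  exact (T.edge_isRealSegment a b hab).eq_of_dist_eq_of_dist_eq (left_mem_metricSegment _ _)
    (right_mem_metricSegment _ _) hgx hxab (coe_ne_coe_of_adj hab) hax hbx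

theorem exists_vertexBall_eq_one_of_fixing
    (hL : ∀ u v : T.vertices, T.graph.Adj u v → dist (u : X) v ≤ L) (hL0 : 0 ≤ L)
    (H : Subgroup T.isom) [DiscreteTopology H] (v : X) :
    ∃ r, ∀ g ∈ H, (∀ x ∈ T.vertexBall v r, g • x = x) → g = 1 := by
  obtain ⟨K, hK, hKH⟩ := exists_isCompact_eq_one_of_fixing H
  obtain ⟨r, hr⟩ := hK.isBounded.subset_closedBall v
  exact ⟨r + L, fun g hg hgv => hKH g hg fun x hx =>
    smul_eq_self_of_forall_vertexBall hL hL0 hgv (hr hx)⟩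

theorem finite_stabilizer_inf_of_discreteTopology
    (hL : ∀ u v : T.vertices, T.graph.Adj u v → dist (u : X) v ≤ L) (hL0 : 0 ≤ L)
    (H : Subgroup T.isom) [DiscreteTopology H] {v : X} (hv : ∀ r, (T.vertexBall v r).Finite) :
    Finite ↥(MulAction.stabilizer T.isom v ⊓ H) := by
  obtain ⟨r, hr⟩ := exists_vertexBall_eq_one_of_fixing hL hL0 H v
  have : Finite (T.vertexBall v r) := hv r
  let f : ↥(MulAction.stabilizer T.isom v ⊓ H) → T.vertexBall v r → T.vertexBall v r :=
    fun g x => ⟨g • (x : X), smul_mem_vertices _ x.2.1, by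
      have hgv : (g : T.isom) • v = v := g.2.1
      have hgx := dist_smul (g : T.isom) (x : X) v
      rw [hgv] at hgx
      exact hgx.trans_le x.2.2⟩
  refine Finite.of_injective f fun g g' h => Subtype.ext (inv_mul_eq_one.1 ?_)
  refine hr _ (H.mul_mem (H.inv_mem g.2.2) g'.2.2) fun x hx => ?_
  have hgx : (g : T.isom) • x = (g' : T.isom) • x := congrArg Subtype.val (congrFun h ⟨x, hx⟩)
  rw [mul_smul, ← hgx, inv_smul_smul]

end Discrete

section Counting

variable {X' : Type*} [MetricSpace X'] {T' : SimplicialRealTree X'} {Γ : Subgroup T.isom}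
  {ρ : Γ →* T'.isom} {x₀ : X} {x₀' : X'}

theorem Admissible.change_basepoints (h : T.Admissible T' Γ x₀ x₀' ρ) (v : X) (v' : X') :
    T.Admissible T' Γ v v' ρ := by
  intro R hR
  filter_upwards [h (R + 2 * dist x₀ v + 2 * dist v' x₀') (by positivity)] with γ hγ
  linarith [dist_smul_self_le (ρ γ) v' x₀', dist_smul_self_le (γ : T.isom) x₀ v]

theorem Admissible.exists_encard_vertexBall_add_le (hadm : T.Admissible T' Γ x₀ x₀' ρ)
    (hfin : T.FiniteQuotient Γ) (v : X) {v' : X'} (hv' : v' ∈ T'.vertices)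
    [Finite ((MulAction.stabilizer T'.isom v').comap ρ)] :
    ∃ A : ℕ, ∀ R > 0, ∃ B : ℕ, ∀ r,
      (T.vertexBall v (r + R)).encard ≤ A * (T'.vertexBall v' r).encard + B := by
  obtain ⟨m, M, hM, hm⟩ := hfin.exists_encard_vertexBall_le v
  set S : Set Γ := ↑((MulAction.stabilizer T'.isom v').comap ρ)
  refine ⟨S.ncard * m, fun R hR => ?_⟩
  have hE := Filter.eventually_cofinite.1
    (hadm.change_basepoints v v' (R + M) (by positivity))
  set E := {γ : Γ | ¬ dist v' (ρ γ • v') ≤ dist v ((γ : T.isom) • v) - (R + M)}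
  refine ⟨E.ncard * m, fun r => ?_⟩
  have hsub : {γ : Γ | dist v ((γ : T.isom) • v) ≤ r + R + M} ⊆
      {γ : Γ | ρ γ • v' ∈ T'.vertexBall v' r} ∪ E := by
    intro γ (hγ : dist v ((γ : T.isom) • v) ≤ r + R + M)
    refine or_iff_not_imp_right.2 fun hγE => ⟨smul_mem_vertices _ hv', ?_⟩
    rw [Metric.mem_closedBall, dist_comm]
    linarith [not_not.1 hγE]
  calc (T.vertexBall v (r + R)).encard
      ≤ {γ : Γ | dist v ((γ : T.isom) • v) ≤ r + R + M}.encard * m := hm _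
    _ ≤ ((T'.vertexBall v' r).encard * S.encard + E.encard) * m := by
        gcongr
        exact (Set.encard_le_encard hsub).trans <| (Set.encard_union_le _ _).trans <| by
          gcongr
          exact encard_setOf_smul_mem_le ρ v' _
    _ = (S.ncard * m : ℕ) * (T'.vertexBall v' r).encard + (E.ncard * m : ℕ) := by
        rw [← S.toFinite.cast_ncard_eq, ← hE.cast_ncard_eq]
        push_cast
        ring

end Counting

section Valences

variable {n₁ n₂ : ℕ}

theorem IsBipartiteOfValences.encard_neighborSet_eq_or (h : T.IsBipartiteOfValences n₁ n₂)
    (v : T.vertices) :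
    (T.graph.neighborSet v).encard = n₁ ∨ (T.graph.neighborSet v).encard = n₂ := by
  obtain ⟨first, -, h₁, h₂⟩ := h
  exact (em (v ∈ first)).imp (h₁ v) (h₂ v)

theorem IsBipartiteOfValences.finite_neighborSet (h : T.IsBipartiteOfValences n₁ n₂)
    (v : T.vertices) : (T.graph.neighborSet v).Finite :=
  (h.encard_neighborSet_eq_or v).elim Set.finite_of_encard_eq_coe Set.finite_of_encard_eq_coe

theorem IsBipartiteOfValences.le_encard_neighborSet (h : T.IsBipartiteOfValences n₁ n₂) {n : ℕ}
    (hn₁ : n ≤ n₁) (hn₂ : n ≤ n₂) (v : T.vertices) : n ≤ (T.graph.neighborSet v).encard := by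
  rcases h.encard_neighborSet_eq_or v with h | h <;> rw [h] <;> exact_mod_cast ‹_›

theorem IsBipartiteOfValences.le_encard_neighborSet_or (h : T.IsBipartiteOfValences n₁ n₂) {n : ℕ}
    (hn : n ≤ n₁ ∨ n ≤ n₂) {u v : T.vertices} (huv : T.graph.Adj u v) :
    n ≤ (T.graph.neighborSet u).encard ∨ n ≤ (T.graph.neighborSet v).encard := by
  obtain ⟨first, hfirst, h₁, h₂⟩ := h
  by_cases hu : u ∈ first
  · rw [h₁ u hu, h₂ v ((hfirst u v huv).1 hu)]
    exact_mod_cast hn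
  · rw [h₂ u hu, h₁ v (not_not.1 (mt (hfirst u v huv).2 hu))]
    exact_mod_cast hn.symm

end Valences

end SimplicialRealTree

section Growth

variable {c : ℝ}

theorem two_pow_mul_le_of_two_mul_le {b : ℝ → ℕ} (hb : ∀ r, 2 * b r ≤ b (r + c)) (k : ℕ) (r : ℝ) :
    2 ^ k * b r ≤ b (r + k * c) := by
  induction k with
  | zero => rw [pow_zero, one_mul, Nat.cast_zero, zero_mul, add_zero]
  | succ k ih =>
    calc 2 ^ (k + 1) * b r = 2 * (2 ^ k * b r) := by rw [pow_succ', mul_assoc]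
      _ ≤ 2 * b (r + k * c) := Nat.mul_le_mul_left 2 ih
      _ ≤ b (r + k * c + c) := hb _
      _ = b (r + (k + 1 : ℕ) * c) := by rw [Nat.cast_succ, add_one_mul, add_assoc]

theorem exists_forall_mul_add_lt_of_two_mul_le {b : ℝ → ℕ∞} (hc : 0 < c) (hfin : ∀ r, b r ≠ ⊤)
    (hb0 : b 0 ≠ 0) (hb : ∀ r, 2 * b r ≤ b (r + c)) (A : ℕ) :
    ∃ R > 0, ∀ B : ℕ, ∃ r, A * b r + B < b (r + R) := by
  lift b to ℝ → ℕ using hfin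
  beta_reduce at hb0 hb ⊢
  norm_cast at hb0 hb ⊢
  refine ⟨(A + 1 : ℕ) * c, by positivity, fun B => ⟨B * c, ?_⟩⟩
  have hB : B < b (B * c) :=
    calc B < 2 ^ B := B.lt_two_pow_self
      _ ≤ 2 ^ B * b 0 := Nat.le_mul_of_pos_right _ (Nat.pos_of_ne_zero hb0)
      _ ≤ b (B * c) := by simpa only [zero_add] using two_pow_mul_le_of_two_mul_le hb B 0
  calc A * b (B * c) + B < A * b (B * c) + b (B * c) := Nat.add_lt_add_left hB _
    _ = (A + 1) * b (B * c) := (add_one_mul _ _).symm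
    _ ≤ 2 ^ (A + 1) * b (B * c) := Nat.mul_le_mul_right _ Nat.lt_two_pow_self.le
    _ ≤ b (B * c + (A + 1 : ℕ) * c) := two_pow_mul_le_of_two_mul_le hb _ _

end Growth

theorem mainTheorem9_general {X : Type*} [MetricSpace X] (T : SimplicialRealTree X)
    (hlf : ∀ v, (T.graph.neighborSet v).Finite)
    (h2 : ∀ v, 2 ≤ (T.graph.neighborSet v).encard)
    (h3 : ∀ u v, T.graph.Adj u v →
      3 ≤ (T.graph.neighborSet u).encard ∨ 3 ≤ (T.graph.neighborSet v).encard)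
    (Γ₀ : Subgroup T.isom) (hfin : T.FiniteQuotient Γ₀) (x₀ x₀' : X) :
    ¬ ∃ ρ : Γ₀ →* T.isom,
      T.Admissible T Γ₀ x₀ x₀' ρ ∧ Finite ρ.ker ∧ DiscreteTopology ρ.range := by
  rintro ⟨ρ, hadm, hker, hdisc⟩
  obtain ⟨ℓ, hℓ, L, hL, hT⟩ := hfin.exists_dist_bounds
  have hLT := fun u v huv => (hT u v huv).2
  obtain ⟨v⟩ := T.isTree.1.nonempty
  have hball := SimplicialRealTree.finite_vertexBall hℓ (fun u v huv => (hT u v huv).1) hlf v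
  have hstab := finite_comap_of_finite_ker ρ
    (SimplicialRealTree.finite_stabilizer_inf_of_discreteTopology hLT hL.le ρ.range hball)
  have hv : (v : X) ∈ T.vertexBall v 0 := ⟨v.2, Metric.mem_closedBall_self le_rfl⟩
  obtain ⟨A, hA⟩ := hadm.exists_encard_vertexBall_add_le hfin v v.2
  obtain ⟨R, hR, hlt⟩ := exists_forall_mul_add_lt_of_two_mul_le (by positivity)
    (fun r => Set.encard_ne_top_iff.2 (hball r)) (Set.encard_ne_zero.2 ⟨v, hv⟩)
    (SimplicialRealTree.two_mul_encard_vertexBall_le hLT h2 h3 v) A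
  obtain ⟨B, hB⟩ := hA R hR
  obtain ⟨r, hr⟩ := hlt B
  exact hr.not_ge (hB r)

theorem mainTheorem9 {X : Type*} [MetricSpace X] (T : SimplicialRealTree X)
    (n₁ n₂ : ℕ) (hn₁ : 2 ≤ n₁) (hn₂ : 2 ≤ n₂) (hn : ¬ (n₁ = 2 ∧ n₂ = 2))
    (hval : T.IsBipartiteOfValences n₁ n₂) (hlen : T.EdgesOfEqualLength)
    (Γ₀ : Subgroup T.isom) (hdisc : DiscreteTopology Γ₀)
    (htf : ∀ γ ∈ Γ₀, γ ≠ 1 → ¬ IsOfFinOrder γ)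
    (hfin : T.FiniteQuotient Γ₀) (x₀ x₀' : X) :
    ¬ ∃ ρ : Γ₀ →* T.isom,
      T.Admissible T Γ₀ x₀ x₀' ρ ∧ Function.Injective ρ ∧ DiscreteTopology ρ.range := by
  rintro ⟨ρ, hadm, hinj, hdisc'⟩
  have h3 : 3 ≤ n₁ ∨ 3 ≤ n₂ := by omega
  exact mainTheorem9_general T hval.finite_neighborSet (hval.le_encard_neighborSet hn₁ hn₂)
    (fun u v => hval.le_encard_neighborSet_or h3) Γ₀ hfin x₀ x₀'
    ⟨ρ, hadm, ρ.ker_eq_bot_iff.2 hinj ▸ inferInstance, hdisc'⟩
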